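/- Let $n\ge 1$, let $\mathbb{B}^n$ be the open unit ball of $\mathbb{C}^n$, $d(z)$ the Euclidean distance from $z$ to $\partial\mathbb{B}^n$, $dV_N$ the normalized Lebesgue volume measure on $\mathbb{B}^n$, and $d\sigma$ the normalized surface measure on $\partial\mathbb{B}^n$. For $f\in\mathcal{C}^1(\mathbb{B}^n)$ (complex-valued, continuously differentiable in the real sense) write $$\|D_f\|=\Big(\sum_{k=1}^n\big(|f_{z_k}|^2+|f_{\overline z_k}|^2\big)\Big)^{1/2},\qquad f_{z_k}=\tfrac12\Big(\frac{\partial f}{\partial x_k}-i\frac{\partial f}{\partial y_k}\Big),\quad f_{\overline z_k}=\tfrac12\Big(\frac{\partial f}{\partial x_k}+i\frac{\partial f}{\partial y_k}\Big),$$ where $z_k=x_k+iy_k$, and let $\Delta=\sum_{k=1}^n\big(\partial^2/\partial x_k^2+\partial^2/\partial y_k^2\big)$. Let $2\le p<\infty$, $t_1>0$, $t_2>0$, and let $f\in\mathcal{C}^2(\mathbb{B}^n)$ belong to the generalized Hardy space $\mathcal{H}^p_g(\mathbb{B}^n)$, that is, $$\sup_{0<r<1}\Big(\int_{\partial\mathbb{B}^n}|f(r\zeta)|^p\,d\sigma(\zeta)\Big)^{1/p}<\infty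 .$$ Suppose that there are nonnegative continuous functions $a_1,b_1,c_1:\mathbb{B}^n\to\mathbb{R}$ such that $$\Delta\big(|f(z)|^p\big)\ \ge\ a_1(z)\|D_f(z)\|^{t_1}+b_1(z)|f(z)|^{t_2}+c_1(z)\qquad\text{for all } z\in\mathbb{B}^n,$$ with $\inf_{\mathbb{B}^n}a_1+\inf_{\mathbb{B}^n}b_1>0$ and $\inf_{\mathbb{B}^n}c_1\ge 0$. Then: (1) If $\inf_{\mathbb{B}^n}a_1>0$, then $f$ belongs to the Dirichlet-type space $\mathcal{D}_{1,t_1}(\mathbb{B}^n)$ of all $f\in\mathcal{C}^1(\mathbb{B}^n)$ with $$|f(0)|+\Big(\int_{\mathbb{B}^n}d(z)\,\|D_f(z)\|^{t_1}\,dV_N(z)\Big)^{1/t_1}<\infty .$$ (2) If $\inf_{\mathbb{B}^n}b_1>0$, then $f$ belongs to the Bergman-type space $b_{1,t_2}(\mathbb{B}^n)$ of all $f\in\mathcal{C}^0(\mathbb{B}^n)$ with $$|f(0)|+\Big(\int_{\mathbb{B}^n}d(z)\,|f(z)|^{t_2}\,dV_N(z)\Big)^{1/t_2}<\infty .$$ 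-/

import Mathlib

noncomputable section

namespace BallSpaces

open MeasureTheory Metric Set
open scoped ENNReal

/-- Complex Euclidean `n`-space with the norm `‖z‖ = ⟨z, z⟩ ^ (1 / 2)`. -/
abbrev Cn (n : ℕ) : Type := EuclideanSpace ℂ (Fin n)

/-- The open unit ball of `ℂⁿ`. -/
def unitBall (n : ℕ) : Set (Cn n) := ball 0 1

/-- Euclidean distance from `z` to the boundary of the unit ball. -/
def bdist {n : ℕ} (z : Cn n) : ℝ := infDist z (frontier (unitBall n))

/-- Normalized Lebesgue volume measure on the unit ball. -/
def ballMeasure (n : ℕ) : Measure (Cn n) :=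
  (volume (unitBall n))⁻¹ • (volume : Measure (Cn n)).restrict (unitBall n)

/-- Normalized Lebesgue surface measure on the unit sphere. -/
def sphereMeasure (n : ℕ) : Measure (sphere (0 : Cn n) 1) :=
  ((volume : Measure (Cn n)).toSphere univ)⁻¹ • (volume : Measure (Cn n)).toSphere

/-- `f ∈ C^m(𝔹ⁿ)`: all real partial derivatives up to order `m` are continuous in the ball. -/
def MemC {n : ℕ} (m : ℕ) (f : Cn n → ℂ) : Prop := ContDiffOn ℝ m f (unitBall n)

/-- The real partial derivative `∂f/∂x_k`, where `z_k = x_k + i y_k`. -/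
def partialX {n : ℕ} (f : Cn n → ℂ) (k : Fin n) (z : Cn n) : ℂ :=
  fderiv ℝ f z (EuclideanSpace.single k 1)

/-- The real partial derivative `∂f/∂y_k`, where `z_k = x_k + i y_k`. -/
def partialY {n : ℕ} (f : Cn n → ℂ) (k : Fin n) (z : Cn n) : ℂ :=
  fderiv ℝ f z (EuclideanSpace.single k Complex.I)

/-- `∇f = (f_{z_1}, …, f_{z_n})`, with `f_{z_k} = (∂f/∂x_k - i ∂f/∂y_k) / 2`. -/
def gradZ {n : ℕ} (f : Cn n → ℂ) (z : Cn n) : Cn n :=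
  WithLp.toLp 2 fun k => (1 / 2 : ℂ) * (partialX f k z - Complex.I * partialY f k z)

/-- The conjugate gradient, with entries `(∂f/∂x_k + i ∂f/∂y_k) / 2`. -/
def gradZbar {n : ℕ} (f : Cn n → ℂ) (z : Cn n) : Cn n :=
  WithLp.toLp 2 fun k => (1 / 2 : ℂ) * (partialX f k z + Complex.I * partialY f k z)

/-- The Hilbert–Schmidt semi-norm `‖D_f(z)‖`. -/
def normD {n : ℕ} (f : Cn n → ℂ) (z : Cn n) : ℝ :=
  Real.sqrt (‖gradZ f z‖ ^ 2 + ‖gradZbar f z‖ ^ 2)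

/-- The integral mean `M_p(r, f)`, for a finite exponent `p`. -/
def integralMean {n : ℕ} (p r : ℝ) (f : Cn n → ℂ) : ℝ≥0∞ :=
  (∫⁻ ζ, ‖f (r • (ζ : Cn n))‖ₑ ^ p ∂(sphereMeasure n)) ^ (1 / p)

/-- The Hardy norm `‖f‖_p`, for `p ∈ (0, ∞]`. -/
def hardyNorm {n : ℕ} (p : ℝ≥0∞) (f : Cn n → ℂ) : ℝ≥0∞ :=
  if p = ∞ then ⨆ z ∈ unitBall n, ‖f z‖ₑ
  else ⨆ r ∈ Ioo (0 : ℝ) 1, integralMean p.toReal r f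

/-- The generalized Hardy space `H_g^p(𝔹ⁿ)`, for `p ∈ (0, ∞]`: measurable functions on the ball
all of whose integral means `M_p(r, f)` exist, and with `‖f‖_p < ∞`. -/
structure MemHardy {n : ℕ} (p : ℝ≥0∞) (f : Cn n → ℂ) : Prop where
  measurable : AEMeasurable f (ballMeasure n)
  mean_exists : p ≠ ∞ → ∀ r ∈ Ioo (0 : ℝ) 1,
    AEMeasurable (fun ζ : sphere (0 : Cn n) 1 => f (r • (ζ : Cn n))) (sphereMeasure n)
  norm_lt_top : hardyNorm p f < ∞

/-- The Dirichlet-type energy integral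
`D_f(ν, μ, t) = ∫ d(z)^ν |f(z)|^μ ‖D_f(z)‖^t dV_N(z)`, with values in `[0, ∞]`. -/
def energy {n : ℕ} (f : Cn n → ℂ) (ν μ t : ℝ) : ℝ≥0∞ :=
  ∫⁻ z, ENNReal.ofReal (bdist z) ^ ν * ‖f z‖ₑ ^ μ * ENNReal.ofReal (normD f z) ^ t
    ∂(ballMeasure n)

/-- The Dirichlet-type space `D_{ν,t}(𝔹ⁿ)`, for `ν ≥ 0` and `0 < t < ∞`. -/
structure MemDirichlet {n : ℕ} (ν t : ℝ) (f : Cn n → ℂ) : Prop where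
  memC : MemC 1 f
  norm_lt_top : ‖f 0‖ₑ + energy f ν 0 t ^ (1 / t) < ∞

/-- The Bergman-type space `b_{ν,μ}(𝔹ⁿ)`, for `ν > -1` and `0 < μ < ∞`. -/
structure MemBergman {n : ℕ} (ν μ : ℝ) (f : Cn n → ℂ) : Prop where
  memC : MemC 0 f
  norm_lt_top : ‖f 0‖ₑ + energy f ν μ 0 ^ (1 / μ) < ∞

/-- `f ∈ C^m(𝔹ⁿ)` satisfies the inverse Heinz inequality
`Δ(|f|^p) ≥ a ‖D_f‖^{t₁} + b |f|^{t₂} + c` in the ball with the nonnegative continuous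
coefficients `a`, `b`, `c`. Here `Δ` is Mathlib's Laplacian of the real inner product space
`ℂⁿ = ℝ²ⁿ`, that is, the sum of the second partial derivatives in all `x_k` and `y_k`. -/
structure InverseHeinz {n : ℕ} (m : ℕ) (p t₁ t₂ : ℝ) (a b c : Cn n → ℝ) (f : Cn n → ℂ) :
    Prop where
  memC : MemC m f
  cont_a : ContinuousOn a (unitBall n)
  cont_b : ContinuousOn b (unitBall n)
  cont_c : ContinuousOn c (unitBall n)
  nonneg_a : ∀ z ∈ unitBall n, 0 ≤ a z
  nonneg_b : ∀ z ∈ unitBall n, 0 ≤ b z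
  nonneg_c : ∀ z ∈ unitBall n, 0 ≤ c z
  ineq : ∀ z ∈ unitBall n,
    a z * normD f z ^ t₁ + b z * ‖f z‖ ^ t₂ + c z ≤
      Laplacian.laplacian (fun w => ‖f w‖ ^ p) z

end BallSpaces

end

/-! ### Regularity of powers of the norm, and a convex cutoff -/

section

open MeasureTheory Set Filter Topology InnerProductSpace

/-! Put `u = |f|^p`, which is C² because `p ≥ 2`, and subharmonic by the inverse Heinz inequality.
Test `Δu` against `1 - |x|²`, which dominates the distance to the sphere. The distributional
Laplacian of the positive part of `1 - |x|²` is twice the surface measure of the unit sphere minus a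
nonnegative function, so Green's identity formally gives `∫ (1 - |x|²) Δu ≤ 2 sup_r ∫ u(rζ)`, which
is finite by the Hardy condition. Bounding `Δu` below by `inf a₁ · ‖D_f‖^t₁` or `inf b₁ · |f|^t₂`
yields the two claims.

To avoid boundary values of `f`, the positive part is replaced by `ψ(1 - ε - |x|²)` with `ψ` smooth
enough, convex and zero on the negative axis (`exists_contDiff_convex_cutoff`). This test function
is compactly supported in the open ball. `lintegral_sub_norm_sq_mul_laplacian_le` is the resulting
estimate for fixed `ε`, and Fatou's lemma removes `ε`. -/

theorem hasFDerivAt_norm_rpow_smul_self {F : Type*} [NormedAddCommGroup F]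
    [InnerProductSpace ℝ F] {q : ℝ} (hq : 0 < q) (x : F) :
    HasFDerivAt (fun x : F => ‖x‖ ^ q • x)
      (‖x‖ ^ q • ContinuousLinearMap.id ℝ F
        + (q * ‖x‖ ^ (q - 2)) • (innerSL ℝ x).smulRight x) x := by
  by_cases hx : x = 0
  · subst hx
    -- Whatever value `0 ^ (q - 2)` takes, the factor `innerSL ℝ 0` kills the second term.
    have h0 : (‖(0 : F)‖ ^ q • ContinuousLinearMap.id ℝ F
        + (q * ‖(0 : F)‖ ^ (q - 2)) • (innerSL ℝ (0 : F)).smulRight (0 : F)) = 0 := by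
      simp [Real.zero_rpow hq.ne']
    rw [h0]
    refine .of_isLittleO ?_
    have h1 : (fun x : F => ‖x‖ ^ q) =o[𝓝 0] (fun _ : F => (1 : ℝ)) := by
      refine (Asymptotics.isLittleO_const_iff one_ne_zero).mpr ?_
      have : ContinuousAt (fun x : F => ‖x‖ ^ q) 0 :=
        continuousAt_id.norm.rpow_const (.inr hq.le)
      simpa [ContinuousAt, Real.zero_rpow hq.ne'] using this
    simpa using h1.smul_isBigO (Asymptotics.isBigO_refl (fun x : F => x) (𝓝 0))
  · have h1 : HasFDerivAt (fun x : F => ‖x‖ ^ q) ((q * ‖x‖ ^ (q - 2)) • innerSL ℝ x) x := by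
      apply HasStrictFDerivAt.hasFDerivAt
      convert! (hasStrictFDerivAt_norm_sq x).rpow_const (p := q / 2) (by simp [hx]) using 0
      simp_rw [← Real.rpow_natCast_mul (norm_nonneg _), ← Nat.cast_smul_eq_nsmul ℝ, smul_smul]
      ring_nf
    refine (h1.smul (hasFDerivAt_id x)).congr_fderiv ?_
    ext v
    simp [smul_smul]

/-- The singular part of the derivative has norm `q ‖x‖ ^ q`, which tends to 0 at the origin. With
`q = p - 2` this map is, up to the factor `p`, the gradient of `‖x‖ ^ p`. -/
theorem contDiff_norm_rpow_smul_self {F : Type*} [NormedAddCommGroup F]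
    [InnerProductSpace ℝ F] {q : ℝ} (hq : 0 < q) :
    ContDiff ℝ 1 (fun x : F => ‖x‖ ^ q • x) := by
  rw [contDiff_one_iff_fderiv]
  refine ⟨fun x => (hasFDerivAt_norm_rpow_smul_self hq x).differentiableAt, ?_⟩
  have hd : fderiv ℝ (fun x : F => ‖x‖ ^ q • x) = fun x => ‖x‖ ^ q • ContinuousLinearMap.id ℝ F
      + (q * ‖x‖ ^ (q - 2)) • (innerSL ℝ x).smulRight x :=
    funext fun x => (hasFDerivAt_norm_rpow_smul_self hq x).fderiv
  rw [hd, continuous_iff_continuousAt]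
  intro x
  have h1 (x : F) : ContinuousAt (fun x : F => ‖x‖ ^ q) x :=
    continuousAt_id.norm.rpow_const (.inr hq.le)
  refine ((h1 x).smul continuousAt_const).add ?_
  by_cases hx : x = 0
  · subst hx
    have h2 : Tendsto (fun x : F => q * ‖x‖ ^ q) (𝓝 0) (𝓝 0) := by
      simpa [ContinuousAt, Real.zero_rpow hq.ne'] using (h1 0).const_mul q
    have h3 : Tendsto (fun x : F => (q * ‖x‖ ^ (q - 2)) • (innerSL ℝ x).smulRight x)
        (𝓝 0) (𝓝 0) := by
      refine squeeze_zero_norm (fun x => ?_) h2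
      rw [norm_smul, ContinuousLinearMap.norm_smulRight_apply, innerSL_apply_norm,
        Real.norm_of_nonneg (by positivity)]
      rcases eq_or_ne x 0 with rfl | hx
      · simp [Real.zero_rpow hq.ne']
      · have : ‖x‖ ^ q = ‖x‖ ^ (q - 2) * (‖x‖ * ‖x‖) := by
          rw [← pow_two, ← Real.rpow_natCast, ← Real.rpow_add (norm_pos_iff.2 hx)]
          norm_num
        rw [this, mul_assoc]
    simpa [ContinuousAt] using h3
  · have h4 : ContinuousAt (fun x : F => ‖x‖ ^ (q - 2)) x :=
      continuousAt_id.norm.rpow_const (.inl (by simpa using hx))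
    have h5 : Continuous (fun x : F => (innerSL ℝ x).smulRight x) := by fun_prop
    exact (continuousAt_const.mul h4).smul h5.continuousAt

theorem contDiff_two_norm_rpow {F : Type*} [NormedAddCommGroup F]
    [InnerProductSpace ℝ F] {p : ℝ} (hp : 2 ≤ p) : ContDiff ℝ 2 (fun x : F => ‖x‖ ^ p) := by
  rcases hp.eq_or_lt with rfl | hp
  · simpa using contDiff_norm_sq ℝ (E := F)
  · rw [show (2 : WithTop ℕ∞) = 1 + 1 by norm_num, contDiff_succ_iff_fderiv]
    refine ⟨differentiable_norm_rpow (by linarith), by simp, ?_⟩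
    have h : fderiv ℝ (fun x : F => ‖x‖ ^ p) =
        fun x => p • innerSL ℝ (‖x‖ ^ (p - 2) • x) := by
      ext1 x
      rw [fderiv_norm_rpow x (by linarith), map_smul, smul_smul]
    rw [h]
    exact ((innerSL ℝ).contDiff.comp
      (contDiff_norm_rpow_smul_self (by linarith : 0 < p - 2))).const_smul p

/-- A regularised positive part: `ψ` is the primitive of a smooth step that rises from 0 to 1 on
`[0, ε]`. Delaying the slope 1 until `ε` costs at most `ε` in height. -/
theorem exists_contDiff_convex_cutoff {ε : ℝ} (hε : 0 < ε) :
    ∃ ψ : ℝ → ℝ, ContDiff ℝ 2 ψ ∧ (∀ s ≤ 0, ψ s = 0) ∧ (∀ s, 0 ≤ ψ s) ∧ (∀ s, s - ε ≤ ψ s) ∧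
      (∀ s, deriv ψ s ∈ Icc (0 : ℝ) 1) ∧ (∀ s, 0 ≤ deriv (deriv ψ) s) ∧
      ∀ s ≤ 0, deriv (deriv ψ) s = 0 := by
  set T : ℝ → ℝ := fun s => Real.smoothTransition (s / ε) with hT
  have hTc : ContDiff ℝ 1 T :=
    (Real.smoothTransition.contDiff (n := 1)).comp (contDiff_id.div_const ε)
  have hT0 : ∀ s ≤ 0, T s = 0 := fun s hs =>
    Real.smoothTransition.zero_of_nonpos (div_nonpos_of_nonpos_of_nonneg hs hε.le)
  have hTn : ∀ s, 0 ≤ T s := fun s => Real.smoothTransition.nonneg _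
  have hd (s : ℝ) : HasDerivAt (fun s => ∫ x in (0 : ℝ)..s, T x) (T s) s :=
    hTc.continuous.integral_hasStrictDerivAt 0 s |>.hasDerivAt
  have hd' : deriv (fun s => ∫ x in (0 : ℝ)..s, T x) = T := funext fun s => (hd s).deriv
  have hz : ∀ s ≤ 0, (∫ x in (0 : ℝ)..s, T x) = 0 := fun s hs => by
    rw [intervalIntegral.integral_congr (g := fun _ => 0)]
    · simp
    · intro x hx
      rw [uIcc_of_ge hs] at hx
      exact hT0 x hx.2
  have hn : ∀ s, 0 ≤ ∫ x in (0 : ℝ)..s, T x := fun s => by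
    rcases le_total s 0 with hs | hs
    · rw [hz s hs]
    · exact intervalIntegral.integral_nonneg hs fun x _ => hTn x
  refine ⟨fun s => ∫ x in (0 : ℝ)..s, T x, ?_, hz, hn, fun s => ?_, fun s => ?_, fun s => ?_,
    fun s hs => ?_⟩
  · rw [show (2 : WithTop ℕ∞) = 1 + 1 by norm_num, contDiff_succ_iff_deriv, hd']
    exact ⟨fun s => (hd s).differentiableAt, by simp, hTc⟩
  · rcases le_total s ε with hs | hs
    · exact (sub_nonpos.2 hs).trans (hn s)
    · change s - ε ≤ ∫ x in (0 : ℝ)..s, T x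
      have hi (a b : ℝ) : IntervalIntegrable T volume a b := hTc.continuous.intervalIntegrable a b
      have h1 : ∫ x in ε..s, T x = s - ε := by
        rw [intervalIntegral.integral_congr (g := fun _ => 1)]
        · simp
        · intro x hx
          rw [uIcc_of_le hs] at hx
          exact Real.smoothTransition.one_of_one_le ((one_le_div hε).2 hx.1)
      rw [← intervalIntegral.integral_add_adjacent_intervals (hi 0 ε) (hi ε s), h1]
      linarith [hn ε]
  · rw [hd']
    exact ⟨hTn s, Real.smoothTransition.le_one _⟩
  · rw [hd']
    exact Monotone.deriv_nonneg fun a b hab =>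
      Real.smoothTransition.monotone (by gcongr)
  · rw [hd']
    -- The step function attains its minimum 0 at every `s ≤ 0`, which also covers the endpoint `s =
    -- 0`.
    exact IsLocalMin.deriv_eq_zero (Eventually.of_forall fun t => by rw [hT0 s hs]; exact hTn t)

/-! ### Laplacian of radial functions, Green's identity, polar coordinates -/

section

variable {E : Type*} [NormedAddCommGroup E] [InnerProductSpace ℝ E]

theorem ContDiffAt.fderiv_fderiv_apply {f : E → ℝ} {x : E} (hf : ContDiffAt ℝ 2 f x) (v w : E) :
    fderiv ℝ (fun y => fderiv ℝ f y v) x w = fderiv ℝ (fderiv ℝ f) x w v := by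
  have h : DifferentiableAt ℝ (fderiv ℝ f) x :=
    (hf.fderiv_right (m := 1) (by norm_num)).differentiableAt (by norm_num)
  rw [fderiv_clm_apply h (differentiableAt_const v)]
  simp

theorem ContDiffAt.laplacian_eq_sum [FiniteDimensional ℝ E] {f : E → ℝ} {x : E}
    (hf : ContDiffAt ℝ 2 f x) :
    Laplacian.laplacian f x = ∑ i, fderiv ℝ (fun y => fderiv ℝ f y (stdOrthonormalBasis ℝ E i)) x
      (stdOrthonormalBasis ℝ E i) := by
  rw [laplacian_eq_iteratedFDeriv_stdOrthonormalBasis]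
  refine Finset.sum_congr rfl fun i _ => ?_
  rw [hf.fderiv_fderiv_apply, iteratedFDeriv_two_apply]
  rfl

/-- The exact Laplacian is `4 ψ'' ‖x‖² - 2 (dim E) ψ'`; monotonicity of `ψ` allows the last term to
be dropped. -/
theorem laplacian_comp_sub_norm_sq_le [FiniteDimensional ℝ E] {ψ : ℝ → ℝ} (hψ : ContDiff ℝ 2 ψ)
    (hψ' : ∀ s, 0 ≤ deriv ψ s) (c : ℝ) (x : E) :
    Laplacian.laplacian (fun x : E => ψ (c - ‖x‖ ^ 2)) x ≤
      4 * deriv (deriv ψ) (c - ‖x‖ ^ 2) * ‖x‖ ^ 2 := by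
  have hs (x : E) : HasFDerivAt (fun x : E => c - ‖x‖ ^ 2) (-(2 • innerSL ℝ x)) x :=
    (hasStrictFDerivAt_norm_sq x).hasFDerivAt.const_sub c
  have hφ : ContDiff ℝ 2 (fun x : E => ψ (c - ‖x‖ ^ 2)) :=
    hψ.comp (contDiff_const.sub (contDiff_norm_sq ℝ))
  have h1 (x v : E) : fderiv ℝ (fun x : E => ψ (c - ‖x‖ ^ 2)) x v =
      deriv ψ (c - ‖x‖ ^ 2) * (-(2 * inner ℝ x v)) := by
    have := ((hψ.differentiable (by norm_num) _).hasDerivAt.comp_hasFDerivAt x (hs x)).fderiv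
    simp only [Function.comp_def] at this
    rw [this]
    simp
  have hψ1 : ContDiff ℝ 1 (deriv ψ) := by
    have : ContDiff ℝ (1 + 1) ψ := by simpa [one_add_one_eq_two] using hψ
    exact (contDiff_succ_iff_deriv.1 this).2.2
  have h2 (x v : E) : fderiv ℝ (fun y => fderiv ℝ (fun x : E => ψ (c - ‖x‖ ^ 2)) y v) x v =
      4 * deriv (deriv ψ) (c - ‖x‖ ^ 2) * inner ℝ x v ^ 2
        - 2 * deriv ψ (c - ‖x‖ ^ 2) * ‖v‖ ^ 2 := by
    have ha := (hψ1.differentiable (by norm_num) _).hasDerivAt.comp_hasFDerivAt x (hs x)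
    have hb : HasFDerivAt (fun y : E => -(2 * inner ℝ y v)) (-((2 : ℝ) • innerSL ℝ v)) x := by
      have : HasFDerivAt (fun y : E => inner ℝ y v) (innerSL ℝ v) x := by
        simpa [real_inner_comm] using (innerSL ℝ v).hasFDerivAt (x := x)
      exact (this.const_mul 2).neg
    have hc := (ha.mul hb).fderiv
    simp only [Function.comp_def] at hc
    simp_rw [h1]
    rw [show (fun y : E => deriv ψ (c - ‖y‖ ^ 2) * -(2 * inner ℝ y v)) =
      (fun y : E => deriv ψ (c - ‖y‖ ^ 2)) * (fun y : E => -(2 * inner ℝ y v)) from rfl, hc]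
    simp
    ring
  rw [hφ.contDiffAt.laplacian_eq_sum]
  simp_rw [h2]
  have h3 : ∑ i, inner ℝ x (stdOrthonormalBasis ℝ E i) ^ 2 = ‖x‖ ^ 2 := by
    simpa using (stdOrthonormalBasis ℝ E).sum_sq_norm_inner_left x
  rw [Finset.sum_sub_distrib, ← Finset.mul_sum, h3]
  have : 0 ≤ ∑ i, 2 * deriv ψ (c - ‖x‖ ^ 2) * ‖stdOrthonormalBasis ℝ E i‖ ^ 2 :=
    Finset.sum_nonneg fun i _ => mul_nonneg (mul_nonneg zero_le_two (hψ' _)) (sq_nonneg _)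
  linarith

theorem ContDiffAt.continuousAt_laplacian [FiniteDimensional ℝ E] {f : E → ℝ} {x : E}
    (hf : ContDiffAt ℝ 2 f x) : ContinuousAt (Laplacian.laplacian f) x := by
  have h : ContinuousAt (fderiv ℝ (fderiv ℝ f)) x :=
    ((hf.fderiv_right (m := 1) (by norm_num)).fderiv_right (m := 0) (by norm_num)).continuousAt
  rw [laplacian_eq_iteratedFDeriv_stdOrthonormalBasis]
  simp_rw [iteratedFDeriv_two_apply]
  exact tendsto_finsetSum _ fun i _ =>
    (h.clm_apply continuousAt_const).clm_apply continuousAt_const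

variable [FiniteDimensional ℝ E] [MeasurableSpace E] [BorelSpace E] (μ : Measure E)
  [μ.IsAddHaarMeasure]

/-- Two integrations by parts in each basis direction; the compact support of `φ` alone makes every
product integrable. -/
theorem integral_mul_laplacian_eq {φ u : E → ℝ} (hφ : ContDiff ℝ 2 φ) (hu : ContDiff ℝ 2 u)
    (hc : HasCompactSupport φ) :
    ∫ x, φ x * Laplacian.laplacian u x ∂μ = ∫ x, Laplacian.laplacian φ x * u x ∂μ := by
  have hd {f : E → ℝ} (hf : ContDiff ℝ 2 f) (v : E) : ContDiff ℝ 1 (fun y => fderiv ℝ f y v) :=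
    (hf.fderiv_right (m := 1) (by norm_num)).clm_apply contDiff_const
  have hd' {f : E → ℝ} (hf : ContDiff ℝ 1 f) (v : E) : Continuous (fun y => fderiv ℝ f y v) :=
    (hf.continuous_fderiv (by norm_num)).clm_apply continuous_const
  have hc1 (v : E) : HasCompactSupport (fun y => fderiv ℝ φ y v) := hc.fderiv_apply ℝ v
  have hc2 (v : E) : HasCompactSupport (fun x => fderiv ℝ (fun y => fderiv ℝ φ y v) x v) :=
    (hc1 v).fderiv_apply ℝ v
  have i1 (v : E) : Integrable (fun x => φ x * fderiv ℝ (fun y => fderiv ℝ u y v) x v) μ :=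
    (hφ.continuous.mul (hd' (hd hu v) v)).integrable_of_hasCompactSupport hc.mul_right
  have i2 (v : E) : Integrable (fun x => fderiv ℝ (fun y => fderiv ℝ φ y v) x v * u x) μ :=
    ((hd' (hd hφ v) v).mul hu.continuous).integrable_of_hasCompactSupport (hc2 v).mul_right
  have i3 (v : E) : Integrable (fun x => fderiv ℝ φ x v * fderiv ℝ u x v) μ :=
    ((hd hφ v).continuous.mul (hd hu v).continuous).integrable_of_hasCompactSupport
      (hc1 v).mul_right
  have i4 (v : E) : Integrable (fun x => φ x * fderiv ℝ u x v) μ :=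
    (hφ.continuous.mul (hd hu v).continuous).integrable_of_hasCompactSupport hc.mul_right
  have i5 (v : E) : Integrable (fun x => fderiv ℝ φ x v * u x) μ :=
    ((hd hφ v).continuous.mul hu.continuous).integrable_of_hasCompactSupport (hc1 v).mul_right
  have key (v : E) : ∫ x, φ x * fderiv ℝ (fun y => fderiv ℝ u y v) x v ∂μ =
      ∫ x, fderiv ℝ (fun y => fderiv ℝ φ y v) x v * u x ∂μ := by
    rw [integral_mul_fderiv_eq_neg_fderiv_mul_of_integrable (i3 v) (i1 v) (i4 v)
        (fun x _ => hφ.differentiable (by norm_num) x)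
        (fun x _ => (hd hu v).differentiable (by norm_num) x),
      integral_mul_fderiv_eq_neg_fderiv_mul_of_integrable (i2 v) (i3 v) (i5 v)
        (fun x _ => (hd hφ v).differentiable (by norm_num) x)
        (fun x _ => hu.differentiable (by norm_num) x), neg_neg]
  simp_rw [fun x => hu.contDiffAt.laplacian_eq_sum (x := x),
    fun x => hφ.contDiffAt.laplacian_eq_sum (x := x), Finset.mul_sum, Finset.sum_mul]
  rw [integral_finsetSum _ fun i _ => i1 _, integral_finsetSum _ fun i _ => i2 _]
  exact Finset.sum_congr rfl fun i _ => key _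

theorem lintegral_eq_lintegral_Ioi_toSphere {F : E → ENNReal} (hF : Measurable F)
    [Nontrivial E] :
    ∫⁻ x, F x ∂μ = ∫⁻ r in Ioi (0 : ℝ), ENNReal.ofReal (r ^ (Module.finrank ℝ E - 1)) *
      ∫⁻ ζ : Metric.sphere (0 : E) 1, F (r • (ζ : E)) ∂μ.toSphere := by
  have hm : Measurable fun q : Metric.sphere (0 : E) 1 × ℝ => F (q.2 • (q.1 : E)) := by
    fun_prop
  have hm' : Measurable fun q : Metric.sphere (0 : E) 1 × Ioi (0 : ℝ) =>
      F ((q.2 : ℝ) • (q.1 : E)) := by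
    fun_prop
  have hm2 : Measurable fun r : ℝ =>
      ∫⁻ ζ : Metric.sphere (0 : E) 1, F (r • (ζ : E)) ∂μ.toSphere :=
    hm.lintegral_prod_left'
  have hm3 : Measurable fun r : Ioi (0 : ℝ) =>
      ∫⁻ ζ : Metric.sphere (0 : E) 1, F ((r : ℝ) • (ζ : E)) ∂μ.toSphere :=
    hm2.comp measurable_subtype_coe
  calc ∫⁻ x, F x ∂μ = ∫⁻ x in ({0}ᶜ : Set E), F x ∂μ := by rw [restrict_compl_singleton]
    _ = ∫⁻ x : ({(0)}ᶜ : Set E), F x ∂(μ.comap (↑)) :=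
      (lintegral_subtype_comap (measurableSet_singleton _).compl _).symm
    _ = ∫⁻ q : Metric.sphere (0 : E) 1 × Ioi (0 : ℝ), F ((q.2 : ℝ) • (q.1 : E))
          ∂μ.toSphere.prod (.volumeIoiPow (Module.finrank ℝ E - 1)) := by
      rw [← μ.measurePreserving_homeomorphUnitSphereProd.lintegral_comp hm']
      refine lintegral_congr fun x => ?_
      congr 1
      have := homeomorphUnitSphereProd_symm_apply_coe E (homeomorphUnitSphereProd E x)
      rwa [Homeomorph.symm_apply_apply] at this
    _ = ∫⁻ r : Ioi (0 : ℝ), ∫⁻ ζ : Metric.sphere (0 : E) 1, F ((r : ℝ) • (ζ : E)) ∂μ.toSphere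
          ∂(.volumeIoiPow (Module.finrank ℝ E - 1)) := lintegral_prod_symm' _ hm'
    _ = _ := by
      rw [Measure.volumeIoiPow, lintegral_withDensity_eq_lintegral_mul _ (by fun_prop) hm3]
      exact lintegral_subtype_comap measurableSet_Ioi
        (fun r : ℝ => ENNReal.ofReal (r ^ (Module.finrank ℝ E - 1)) *
          ∫⁻ ζ : Metric.sphere (0 : E) 1, F (r • (ζ : E)) ∂μ.toSphere)

end

/-! ### The weighted estimate on the unit ball -/

section

variable {E : Type*} [NormedAddCommGroup E] [InnerProductSpace ℝ E] [FiniteDimensional ℝ E]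

/-- Green's identity above asks for functions that are C² on the whole space, while `u` is so only
in the ball. Multiplying by a bump function with values in `[0, 1]` repairs this, and `w ≤ u`
preserves the bounds on spherical means. -/
theorem exists_contDiff_eq_on_closedBall {u : E → ℝ}
    (hu : ContDiffOn ℝ 2 u (Metric.ball 0 1)) (hu0 : ∀ x ∈ Metric.ball (0 : E) 1, 0 ≤ u x)
    {R : ℝ} (hR0 : 0 ≤ R) (hR : R < 1) :
    ∃ w : E → ℝ, ContDiff ℝ 2 w ∧ (∀ x, 0 ≤ w x) ∧ (∀ x ∈ Metric.ball (0 : E) 1, w x ≤ u x) ∧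
      (∀ x, 1 ≤ ‖x‖ → w x = 0) ∧ ∀ x, ‖x‖ ≤ R → w =ᶠ[𝓝 x] u := by
  obtain ⟨ρ, hρ, hρ1⟩ := exists_between hR
  obtain ⟨ρ', hρ', hρ1'⟩ := exists_between hρ1
  let χ : ContDiffBump (0 : E) := ⟨ρ, ρ', hR0.trans_lt hρ, hρ'⟩
  have h0 : ∀ x, ρ' ≤ ‖x‖ → χ x = 0 := fun x hx => χ.zero_of_le_dist (by simpa using hx)
  refine ⟨fun x => χ x * u x, ?_, fun x => ?_, fun x hx => ?_, fun x hx => ?_, fun x hx => ?_⟩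
  · rw [contDiff_iff_contDiffAt]
    intro x
    rcases lt_or_ge ‖x‖ 1 with hx | hx
    · exact χ.contDiffAt.mul (hu.contDiffAt (Metric.isOpen_ball.mem_nhds (by simpa using hx)))
    · have : (fun x => χ x * u x) =ᶠ[𝓝 x] fun _ => 0 := by
        filter_upwards [(isOpen_lt continuous_const continuous_norm).mem_nhds
          (show ρ' < ‖x‖ from hρ1'.trans_le hx)] with y hy
        rw [h0 y (le_of_lt hy), zero_mul]
      exact contDiffAt_const.congr_of_eventuallyEq this
  · rcases lt_or_ge ‖x‖ 1 with hx | hx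
    · exact mul_nonneg χ.nonneg (hu0 x (by simpa using hx))
    · simp [h0 x (hρ1'.le.trans hx)]
  · exact mul_le_of_le_one_left (hu0 x hx) χ.le_one
  · simp [h0 x (hρ1'.le.trans hx)]
  · filter_upwards [χ.eventuallyEq_one_of_mem_ball (x := x)
      (by simpa using hx.trans_lt hρ)] with y hy
    simp [hy]

variable [MeasurableSpace E] [BorelSpace E] (μ : Measure E) [μ.IsAddHaarMeasure]

/-- In polar coordinates the radial weight is at most `4 r g'(c - r²)`, the derivative of `-2 g(c -
r²)`. Its integral over `[0, 1]` is at most 2 because `g` takes values in `[0, 1]`, so the bound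
does not depend on how steep `g` is. -/
theorem lintegral_mul_comp_norm_sq_le (hE : 2 ≤ Module.finrank ℝ E) {g : ℝ → ℝ}
    (hg : ContDiff ℝ 1 g) (hgI : ∀ s, g s ∈ Icc (0 : ℝ) 1) (hg' : ∀ s, 0 ≤ deriv g s) {c : ℝ}
    (hg0 : ∀ s ≤ c - 1, deriv g s = 0) {w : E → ℝ} (hw : Continuous w) {M : ENNReal}
    (hM : ∀ r ∈ Ioo (0 : ℝ) 1,
      ∫⁻ ζ : Metric.sphere (0 : E) 1, ENNReal.ofReal (w (r • (ζ : E))) ∂μ.toSphere ≤ M) :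
    ∫⁻ x, ENNReal.ofReal (4 * deriv g (c - ‖x‖ ^ 2) * w x) ∂μ ≤ 2 * M := by
  have : Nontrivial E := Module.nontrivial_of_finrank_pos (R := ℝ) (by omega)
  have hgc : Continuous (deriv g) := hg.continuous_deriv (by norm_num)
  set G : ℝ → ℝ := fun r => 4 * r * deriv g (c - r ^ 2) with hG
  have hGc : Continuous G := by fun_prop
  have hGint : ∫⁻ r in Ioc (0 : ℝ) 1, ENNReal.ofReal (G r) ≤ 2 := by
    rw [← ofReal_integral_eq_lintegral_ofReal (hGc.intervalIntegrable 0 1).1,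
      ← intervalIntegral.integral_of_le zero_le_one,
      intervalIntegral.integral_eq_sub_of_hasDerivAt (f := fun r => -2 * g (c - r ^ 2))
        (fun r _ => ?_) (hGc.intervalIntegrable 0 1)]
    · refine (ENNReal.ofReal_le_ofReal (q := 2) ?_).trans_eq (by simp)
      have h1 := (hgI (c - 1 ^ 2)).1
      have h2 := (hgI (c - 0 ^ 2)).2
      linarith
    · have h1 : HasDerivAt (fun r : ℝ => c - r ^ 2) (-(2 * r)) r := by
        simpa using (hasDerivAt_pow 2 r).const_sub c
      have h2 := ((hg.differentiable (by norm_num) (c - r ^ 2)).hasDerivAt.comp r h1).const_mul (-2)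
      simp only [Function.comp_def] at h2
      exact h2.congr_deriv (by simp only [hG]; ring)
    · filter_upwards [ae_restrict_mem measurableSet_Ioc] with r hr
      exact mul_nonneg (mul_nonneg (by norm_num) hr.1.le) (hg' _)
  rw [lintegral_eq_lintegral_Ioi_toSphere μ (by fun_prop)]
  calc _ ≤ ∫⁻ r in Ioc (0 : ℝ) 1, ENNReal.ofReal (G r) * M := by
        rw [← lintegral_indicator measurableSet_Ioi, ← lintegral_indicator measurableSet_Ioc]
        refine lintegral_mono fun r => ?_
        by_cases hr : r ∈ Ioi (0 : ℝ)
        swap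
        · rw [indicator_of_notMem hr]; exact zero_le
        rw [indicator_of_mem hr]
        have hn (ζ : Metric.sphere (0 : E) 1) : ‖r • (ζ : E)‖ = r := by
          simp [norm_smul, abs_of_pos (mem_Ioi.1 hr)]
        simp_rw [hn]
        rcases lt_or_ge r 1 with h1 | h1
        · rw [indicator_of_mem (show r ∈ Ioc (0 : ℝ) 1 from ⟨hr, h1.le⟩)]
          have h4 : 0 ≤ 4 * deriv g (c - r ^ 2) := mul_nonneg (by norm_num) (hg' _)
          simp_rw [ENNReal.ofReal_mul h4]
          rw [lintegral_const_mul _ (by fun_prop), ← mul_assoc,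
            ← ENNReal.ofReal_mul (pow_nonneg (le_of_lt hr) _)]
          refine mul_le_mul' (ENNReal.ofReal_le_ofReal ?_) (hM r ⟨hr, h1⟩)
          -- Real dimension at least 2 makes the exponent at least 1.
          have h5 : r ^ (Module.finrank ℝ E - 1) ≤ r :=
            pow_le_of_le_one (le_of_lt hr) h1.le (by omega)
          calc r ^ (Module.finrank ℝ E - 1) * (4 * deriv g (c - r ^ 2))
              ≤ r * (4 * deriv g (c - r ^ 2)) := mul_le_mul_of_nonneg_right h5 h4
            _ = G r := by simp only [hG]; ring
        · simp [hg0 (c - r ^ 2) (by nlinarith)]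
    _ = (∫⁻ r in Ioc (0 : ℝ) 1, ENNReal.ofReal (G r)) * M :=
        lintegral_mul_const _ (by fun_prop)
    _ ≤ 2 * M := by gcongr

/-- One `ε` shrinks the support of the test function into the open ball; the other is the loss in `s
- ε ≤ ψ s`. -/
theorem lintegral_sub_norm_sq_mul_laplacian_le (hE : 2 ≤ Module.finrank ℝ E) {u : E → ℝ}
    (hu : ContDiffOn ℝ 2 u (Metric.ball 0 1)) (hu0 : ∀ x ∈ Metric.ball (0 : E) 1, 0 ≤ u x)
    (hΔ : ∀ x ∈ Metric.ball (0 : E) 1, 0 ≤ Laplacian.laplacian u x) {M : ENNReal}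
    (hM : ∀ r ∈ Ioo (0 : ℝ) 1,
      ∫⁻ ζ : Metric.sphere (0 : E) 1, ENNReal.ofReal (u (r • (ζ : E))) ∂μ.toSphere ≤ M)
    {ε : ℝ} (hε : 0 < ε) :
    ∫⁻ x in Metric.ball 0 1, ENNReal.ofReal ((1 - 2 * ε - ‖x‖ ^ 2) * Laplacian.laplacian u x) ∂μ
      ≤ 2 * M := by
  obtain ⟨ψ, hψ, hψ0, hψn, hψε, hψ1, hψ2, hψ20⟩ := exists_contDiff_convex_cutoff hε
  have hψc : ContDiff ℝ 1 (deriv ψ) := by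
    have : ContDiff ℝ (1 + 1) ψ := by simpa [one_add_one_eq_two] using hψ
    exact (contDiff_succ_iff_deriv.1 this).2.2
  have hψ2c : Continuous (deriv (deriv ψ)) := hψc.continuous_deriv (by norm_num)
  -- This also covers `ε > 1`, where the square root is 0 by convention.
  have hR : √(1 - ε) < 1 := by
    rw [Real.sqrt_lt' one_pos]; linarith
  obtain ⟨w, hw, hwn, hwu, hw0, hwe⟩ :=
    exists_contDiff_eq_on_closedBall hu hu0 (Real.sqrt_nonneg (1 - ε)) hR
  set φ : E → ℝ := fun x => ψ (1 - ε - ‖x‖ ^ 2) with hφdef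
  have hφ : ContDiff ℝ 2 φ := hψ.comp (contDiff_const.sub (contDiff_norm_sq ℝ))
  have hφR : ∀ x, φ x ≠ 0 → ‖x‖ ≤ √(1 - ε) := fun x hx => by
    by_contra! h
    refine hx (hψ0 _ ?_)
    have := Real.lt_sq_of_sqrt_lt h
    linarith
  have hφc : HasCompactSupport φ :=
    HasCompactSupport.of_support_subset_isCompact (isCompact_closedBall (0 : E) √(1 - ε))
      fun x hx => by simpa using hφR x hx
  have hwc : HasCompactSupport w :=
    HasCompactSupport.of_support_subset_isCompact (isCompact_closedBall (0 : E) 1)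
      fun x hx => by
        by_contra h
        exact hx (hw0 x (by simpa using (not_le.1 (by simpa using h)).le))
  have hcΔ {f : E → ℝ} (hf : ContDiff ℝ 2 f) : Continuous (Laplacian.laplacian f) :=
    continuous_iff_continuousAt.2 fun x => hf.contDiffAt.continuousAt_laplacian
  have hΔe : ∀ x, φ x ≠ 0 → Laplacian.laplacian w x = Laplacian.laplacian u x := fun x hx =>
    (laplacian_congr_nhds (hwe x (hφR x hx))).self_of_nhds
  have hφΔ : ∀ x, 0 ≤ φ x * Laplacian.laplacian w x := fun x => by
    by_cases hx : φ x = 0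
    · simp [hx]
    · rw [hΔe x hx]
      exact mul_nonneg (hψn _) (hΔ x (by simpa using (hφR x hx).trans_lt hR))
  have hi1 : Integrable (fun x => φ x * Laplacian.laplacian w x) μ :=
    (hφ.continuous.mul (hcΔ hw)).integrable_of_hasCompactSupport hφc.mul_right
  have hi2 : Integrable (fun x => Laplacian.laplacian φ x * w x) μ :=
    ((hcΔ hφ).mul hw.continuous).integrable_of_hasCompactSupport hwc.mul_left
  have hi3 : Integrable (fun x => 4 * deriv (deriv ψ) (1 - ε - ‖x‖ ^ 2) * w x) μ :=
    Continuous.integrable_of_hasCompactSupport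
      (by have := hw.continuous; fun_prop) hwc.mul_left
  calc _ ≤ ∫⁻ x in Metric.ball 0 1, ENNReal.ofReal (φ x * Laplacian.laplacian w x) ∂μ := by
        refine setLIntegral_mono' Metric.isOpen_ball.measurableSet fun x hx => ?_
        have h1 : φ x * Laplacian.laplacian w x = φ x * Laplacian.laplacian u x := by
          by_cases hx : φ x = 0
          · simp [hx]
          · rw [hΔe x hx]
        rw [h1]
        refine ENNReal.ofReal_le_ofReal (mul_le_mul_of_nonneg_right ?_ (hΔ x hx))
        have := hψε (1 - ε - ‖x‖ ^ 2)
        simp only [hφdef]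
        linarith
    _ ≤ ∫⁻ x, ENNReal.ofReal (φ x * Laplacian.laplacian w x) ∂μ := setLIntegral_le_lintegral _ _
    _ = ENNReal.ofReal (∫ x, Laplacian.laplacian φ x * w x ∂μ) := by
        rw [← ofReal_integral_eq_lintegral_ofReal hi1 (Eventually.of_forall hφΔ),
          integral_mul_laplacian_eq μ hφ hw hφc]
    _ ≤ ENNReal.ofReal (∫ x, 4 * deriv (deriv ψ) (1 - ε - ‖x‖ ^ 2) * w x ∂μ) := by
        refine ENNReal.ofReal_le_ofReal (integral_mono hi2 hi3 fun x => ?_)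
        rcases lt_or_ge ‖x‖ 1 with hx | hx
        · refine mul_le_mul_of_nonneg_right ?_ (hwn x)
          refine (laplacian_comp_sub_norm_sq_le hψ (fun s => (hψ1 s).1) _ x).trans ?_
          exact mul_le_of_le_one_right (mul_nonneg (by norm_num) (hψ2 _))
            (pow_le_one₀ (norm_nonneg _) hx.le)
        · simp [hw0 x hx]
    _ = ∫⁻ x, ENNReal.ofReal (4 * deriv (deriv ψ) (1 - ε - ‖x‖ ^ 2) * w x) ∂μ :=
        ofReal_integral_eq_lintegral_ofReal hi3 (Eventually.of_forall fun x =>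
          mul_nonneg (mul_nonneg (by norm_num) (hψ2 _)) (hwn x))
    -- Applied with `g = ψ'` and `c = 1 - ε`, so that `s ≤ c - 1` forces `s ≤ 0`, where `ψ''`
    -- vanishes.
    _ ≤ 2 * M := by
        refine lintegral_mul_comp_norm_sq_le μ hE hψc hψ1 hψ2
          (fun s hs => hψ20 s (by linarith)) hw.continuous fun r hr => ?_
        refine (lintegral_mono fun ζ => ENNReal.ofReal_le_ofReal (hwu _ ?_)).trans (hM r hr)
        simpa [norm_smul, abs_of_pos hr.1] using hr.2

/-- Fatou's lemma along `ε = 1 / (k + 2)`, since the bound `2 * M` is uniform in `ε`.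
`ENNReal.ofReal` truncates the negative values of the approximating weights near the sphere. -/
theorem lintegral_one_sub_norm_sq_mul_laplacian_le (hE : 2 ≤ Module.finrank ℝ E) {u : E → ℝ}
    (hu : ContDiffOn ℝ 2 u (Metric.ball 0 1)) (hu0 : ∀ x ∈ Metric.ball (0 : E) 1, 0 ≤ u x)
    (hΔ : ∀ x ∈ Metric.ball (0 : E) 1, 0 ≤ Laplacian.laplacian u x) {M : ENNReal}
    (hM : ∀ r ∈ Ioo (0 : ℝ) 1,
      ∫⁻ ζ : Metric.sphere (0 : E) 1, ENNReal.ofReal (u (r • (ζ : E))) ∂μ.toSphere ≤ M) :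
    ∫⁻ x in Metric.ball 0 1, ENNReal.ofReal ((1 - ‖x‖ ^ 2) * Laplacian.laplacian u x) ∂μ
      ≤ 2 * M := by
  have hc : ContinuousOn (Laplacian.laplacian u) (Metric.ball 0 1) := fun x hx =>
    (hu.contDiffAt (Metric.isOpen_ball.mem_nhds hx)).continuousAt_laplacian.continuousWithinAt
  set ε : ℕ → ℝ := fun k => 1 / ((k : ℝ) + 2) with hεdef
  have hε0 (k : ℕ) : 0 < ε k := by positivity
  have hεt : Tendsto ε atTop (𝓝 0) :=
    tendsto_const_nhds.div_atTop
      (tendsto_atTop_add_const_right _ _ tendsto_natCast_atTop_atTop)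
  have hlim (x : E) : Tendsto
      (fun k => ENNReal.ofReal ((1 - 2 * ε k - ‖x‖ ^ 2) * Laplacian.laplacian u x)) atTop
      (𝓝 (ENNReal.ofReal ((1 - ‖x‖ ^ 2) * Laplacian.laplacian u x))) := by
    refine ENNReal.tendsto_ofReal (Tendsto.mul_const _ ?_)
    simpa using (tendsto_const_nhds.sub (hεt.const_mul 2)).sub_const (‖x‖ ^ 2)
  calc _ = ∫⁻ x in Metric.ball 0 1, liminf (fun k =>
          ENNReal.ofReal ((1 - 2 * ε k - ‖x‖ ^ 2) * Laplacian.laplacian u x)) atTop ∂μ :=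
        lintegral_congr fun x => (hlim x).liminf_eq.symm
    _ ≤ liminf (fun k => ∫⁻ x in Metric.ball 0 1,
          ENNReal.ofReal ((1 - 2 * ε k - ‖x‖ ^ 2) * Laplacian.laplacian u x) ∂μ) atTop := by
        refine lintegral_liminf_le' fun k => AEMeasurable.ennreal_ofReal ?_
        exact (ContinuousOn.mul (by fun_prop) hc).aemeasurable Metric.isOpen_ball.measurableSet
    _ ≤ liminf (fun _ : ℕ => 2 * M) atTop := by
        refine liminf_le_liminf (Eventually.of_forall fun k => ?_)
        exact lintegral_sub_norm_sq_mul_laplacian_le μ hE hu hu0 hΔ hM (hε0 k)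
    _ = 2 * M := liminf_const _

end

/-! ### Application to the function spaces on the ball of `ℂⁿ` -/

namespace BallSpaces

theorem bdist_le_one_sub_norm_sq {n : ℕ} (hn : 1 ≤ n) {z : Cn n} (hz : z ∈ unitBall n) :
    bdist z ≤ 1 - ‖z‖ ^ 2 := by
  have hz1 : ‖z‖ < 1 := by simpa [unitBall] using hz
  have : Nontrivial (Cn n) :=
    Module.nontrivial_of_finrank_pos (R := ℂ) (by rw [finrank_euclideanSpace_fin]; omega)
  -- The radial projection of `z` to the sphere; at the centre any unit vector serves, and one
  -- exists because `n ≥ 1`.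
  obtain ⟨e, he, hze⟩ : ∃ e : Cn n, ‖e‖ = 1 ∧ ‖z‖ • e = z := by
    rcases eq_or_ne z 0 with rfl | h0
    · obtain ⟨e, he⟩ := exists_norm_eq (Cn n) zero_le_one
      exact ⟨e, he, by simp⟩
    · exact ⟨‖z‖⁻¹ • z, by
        rw [norm_smul, norm_inv, norm_norm, inv_mul_cancel₀ (norm_ne_zero_iff.2 h0)],
        smul_inv_smul₀ (norm_ne_zero_iff.2 h0) z⟩
  have hf : e ∈ frontier (unitBall n) := by
    rw [unitBall, frontier_ball (0 : Cn n) one_ne_zero]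
    simpa using he
  have h1 : bdist z ≤ dist z e := Metric.infDist_le_dist_of_mem hf
  have h2 : dist z e = 1 - ‖z‖ := by
    have : z - e = (‖z‖ - 1) • e := by rw [sub_smul, hze, one_smul]
    rw [dist_eq_norm, this, norm_smul, he, mul_one, Real.norm_eq_abs, abs_of_nonpos (by linarith)]
    ring
  nlinarith [norm_nonneg z]

theorem lintegral_sphere_rpow_le_hardyNorm {n : ℕ} {p : ℝ} (hp : 0 < p) (f : Cn n → ℂ)
    {r : ℝ} (hr : r ∈ Ioo (0 : ℝ) 1) :
    ∫⁻ ζ, ‖f (r • (ζ : Cn n))‖ₑ ^ p ∂(sphereMeasure n) ≤ hardyNorm (ENNReal.ofReal p) f ^ p := by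
  have h : integralMean p r f ≤ hardyNorm (ENNReal.ofReal p) f := by
    rw [hardyNorm, if_neg ENNReal.ofReal_ne_top, ENNReal.toReal_ofReal hp.le]
    exact le_iSup₂ (f := fun r (_ : r ∈ Ioo (0 : ℝ) 1) => integralMean p r f) r hr
  rw [integralMean, one_div, ENNReal.rpow_inv_le_iff hp] at h
  exact h

theorem exists_lintegral_toSphere_rpow_le {n : ℕ} (hn : 1 ≤ n) {p : ℝ} (hp : 0 < p)
    {f : Cn n → ℂ} (hf : MemHardy (ENNReal.ofReal p) f) :
    ∃ M : ENNReal, M < ⊤ ∧ ∀ r ∈ Ioo (0 : ℝ) 1,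
      ∫⁻ ζ : Metric.sphere (0 : Cn n) 1, ENNReal.ofReal (‖f (r • (ζ : Cn n))‖ ^ p)
        ∂(volume : Measure (Cn n)).toSphere ≤ M := by
  have : Nontrivial (Cn n) :=
    Module.nontrivial_of_finrank_pos (R := ℂ) (by rw [finrank_euclideanSpace_fin]; omega)
  set S := (volume : Measure (Cn n)).toSphere univ with hS
  have hS0 : S ≠ 0 := by
    rw [hS, Measure.measure_univ_ne_zero]
    exact Measure.toSphere_ne_zero _
  have hST : S ≠ ⊤ := measure_ne_top _ _
  -- The factor `S`, the total mass of the sphere, undoes the normalization in `sphereMeasure`.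
  refine ⟨S * hardyNorm (ENNReal.ofReal p) f ^ p, ENNReal.mul_lt_top hST.lt_top
    (ENNReal.rpow_lt_top_of_nonneg hp.le hf.norm_lt_top.ne), fun r hr => ?_⟩
  have h := lintegral_sphere_rpow_le_hardyNorm hp f hr
  rw [sphereMeasure, lintegral_smul_measure, smul_eq_mul, ← hS,
    ENNReal.inv_mul_le_iff hS0 hST] at h
  refine le_of_eq_of_le (lintegral_congr fun ζ => ?_) h
  rw [← ENNReal.ofReal_rpow_of_nonneg (norm_nonneg _) hp.le, ofReal_norm]

/-- The common core of both claims: `A` stands for the positive infimum of a coefficient and `K` for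
the power it multiplies. The lower bound `A * K` also supplies the subharmonicity of `|f|^p`. -/
theorem lintegral_bdist_mul_lt_top {n : ℕ} (hn : 1 ≤ n) {p : ℝ} (hp : 2 ≤ p) {f : Cn n → ℂ}
    (hf : MemC 2 f) (hfp : MemHardy (ENNReal.ofReal p) f) {A : ℝ} (hA : 0 < A) {K : Cn n → ℝ}
    (hK : ∀ z ∈ unitBall n, 0 ≤ K z)
    (h : ∀ z ∈ unitBall n, A * K z ≤ Laplacian.laplacian (fun w => ‖f w‖ ^ p) z) :
    ∫⁻ z, ENNReal.ofReal (bdist z) * ENNReal.ofReal (K z) ∂(ballMeasure n) < ⊤ := by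
  obtain ⟨M, hM, hMr⟩ := exists_lintegral_toSphere_rpow_le hn (by linarith) hfp
  have hu : ContDiffOn ℝ 2 (fun w => ‖f w‖ ^ p) (Metric.ball (0 : Cn n) 1) :=
    (contDiff_two_norm_rpow hp).comp_contDiffOn (g := fun w : ℂ => ‖w‖ ^ p) hf
  have hE : 2 ≤ Module.finrank ℝ (Cn n) := by
    have : Module.finrank ℝ (Cn n) = 2 * n := by
      rw [finrank_real_of_complex, finrank_euclideanSpace_fin]
    omega
  have key := lintegral_one_sub_norm_sq_mul_laplacian_le volume hE hu
    (fun x _ => Real.rpow_nonneg (norm_nonneg _) _)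
    (fun x hx => (mul_nonneg hA.le (hK x hx)).trans (h x hx)) hMr
  rw [ballMeasure, lintegral_smul_measure, smul_eq_mul]
  refine ENNReal.mul_lt_top (ENNReal.inv_lt_top.2 (Metric.measure_ball_pos _ _ one_pos)) ?_
  calc _ ≤ ∫⁻ z in unitBall n, ENNReal.ofReal A⁻¹ * ENNReal.ofReal
          ((1 - ‖z‖ ^ 2) * Laplacian.laplacian (fun w => ‖f w‖ ^ p) z) := by
        refine setLIntegral_mono' Metric.isOpen_ball.measurableSet fun z hz => ?_
        have h1 := bdist_le_one_sub_norm_sq hn hz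
        have h0 : 0 ≤ bdist z := Metric.infDist_nonneg
        rw [← ENNReal.ofReal_mul h0, ← ENNReal.ofReal_mul (inv_nonneg.2 hA.le)]
        refine ENNReal.ofReal_le_ofReal ?_
        rw [← div_eq_inv_mul, le_div_iff₀ hA]
        calc bdist z * K z * A = bdist z * (A * K z) := by ring
          _ ≤ _ := mul_le_mul h1 (h z hz) (mul_nonneg hA.le (hK z hz)) (h0.trans h1)
    _ = ENNReal.ofReal A⁻¹ * ∫⁻ z in unitBall n, ENNReal.ofReal
          ((1 - ‖z‖ ^ 2) * Laplacian.laplacian (fun w => ‖f w‖ ^ p) z) :=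
        lintegral_const_mul' _ _ ENNReal.ofReal_ne_top
    _ < ⊤ := ENNReal.mul_lt_top ENNReal.ofReal_lt_top
        (key.trans_lt (ENNReal.mul_lt_top (by simp) hM))

/-- Nonnegativity provides the lower bound without which a real infimum carries no information. -/
theorem iInf_unitBall_le {n : ℕ} {a : Cn n → ℝ} (ha : ∀ z ∈ unitBall n, 0 ≤ a z) {z : Cn n}
    (hz : z ∈ unitBall n) : (⨅ z : unitBall n, a z) ≤ a z :=
  ciInf_le (f := fun z : unitBall n => a z) ⟨0, by rintro _ ⟨w, rfl⟩; exact ha w w.2⟩ ⟨z, hz⟩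

end BallSpaces

end

theorem mainTheorem5 (n : ℕ) (hn : 1 ≤ n) (p t₁ t₂ : ℝ) (hp : 2 ≤ p) (ht₁ : 0 < t₁)
    (ht₂ : 0 < t₂) (a₁ b₁ c₁ : BallSpaces.Cn n → ℝ) (f : BallSpaces.Cn n → ℂ)
    (hf : BallSpaces.InverseHeinz 2 p t₁ t₂ a₁ b₁ c₁ f)
    (hfp : BallSpaces.MemHardy (ENNReal.ofReal p) f)
    (hab : 0 < (⨅ z : BallSpaces.unitBall n, a₁ z) + ⨅ z : BallSpaces.unitBall n, b₁ z)
    (hc : 0 ≤ ⨅ z : BallSpaces.unitBall n, c₁ z) :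
    ((0 < ⨅ z : BallSpaces.unitBall n, a₁ z) → BallSpaces.MemDirichlet 1 t₁ f) ∧
      ((0 < ⨅ z : BallSpaces.unitBall n, b₁ z) → BallSpaces.MemBergman 1 t₂ f) := by
  have hD (z : BallSpaces.Cn n) : 0 ≤ BallSpaces.normD f z ^ t₁ :=
    Real.rpow_nonneg (Real.sqrt_nonneg _) _
  have hN (z : BallSpaces.Cn n) : 0 ≤ ‖f z‖ ^ t₂ := Real.rpow_nonneg (norm_nonneg _) _
  refine ⟨fun ha => ⟨ContDiffOn.of_le hf.memC (by norm_num), ?_⟩,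
    fun hb => ⟨ContDiffOn.of_le hf.memC (by norm_num), ?_⟩⟩
  · refine ENNReal.add_lt_top.2 ⟨enorm_lt_top, ENNReal.rpow_lt_top_of_nonneg (by positivity) ?_⟩
    have h := BallSpaces.lintegral_bdist_mul_lt_top hn hp hf.memC hfp ha
      (K := fun z => BallSpaces.normD f z ^ t₁) (fun z _ => hD z) fun z hz => by
        have h1 := mul_le_mul_of_nonneg_right
          (BallSpaces.iInf_unitBall_le hf.nonneg_a hz) (hD z)
        linarith [hf.ineq z hz, mul_nonneg (hf.nonneg_b z hz) (hN z), hf.nonneg_c z hz]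
    -- In the energy the exponent 1 on the distance disappears, and `‖f z‖ₑ ^ 0 = 1` even at zeros
    -- of `f`.
    refine (lt_of_eq_of_lt (MeasureTheory.lintegral_congr fun z => ?_) h).ne
    rw [ENNReal.rpow_one, ENNReal.rpow_zero, mul_one,
      ENNReal.ofReal_rpow_of_nonneg (show 0 ≤ BallSpaces.normD f z from Real.sqrt_nonneg _) ht₁.le]
  · refine ENNReal.add_lt_top.2 ⟨enorm_lt_top, ENNReal.rpow_lt_top_of_nonneg (by positivity) ?_⟩
    have h := BallSpaces.lintegral_bdist_mul_lt_top hn hp hf.memC hfp hb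
      (K := fun z => ‖f z‖ ^ t₂) (fun z _ => hN z) fun z hz => by
        have h1 := mul_le_mul_of_nonneg_right
          (BallSpaces.iInf_unitBall_le hf.nonneg_b hz) (hN z)
        linarith [hf.ineq z hz, mul_nonneg (hf.nonneg_a z hz) (hD z), hf.nonneg_c z hz]
    refine (lt_of_eq_of_lt (MeasureTheory.lintegral_congr fun z => ?_) h).ne
    rw [ENNReal.rpow_one, ENNReal.rpow_zero, mul_one, ← ofReal_norm,
      ENNReal.ofReal_rpow_of_nonneg (norm_nonneg _) ht₂.le]
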